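/- For a real-valued Lipschitz function $h$ on a metric space, let $\operatorname{Lip}(h)$ denote its (least) Lipschitz constant; $\mathcal C^1$-smooth means continuously Fréchet differentiable. A real Banach space $X$ has property $(*)$ if there is a constant $C_0$, depending only on $X$, such that for every Lipschitz function $f:X\to\mathbb R$ and every $\varepsilon>0$ there is a Lipschitz, $\mathcal C^1$-smooth function $K:X\to\mathbb R$ with $|f(x)-K(x)|<\varepsilon$ for all $x\in X$ and $\operatorname{Lip}(K)\le C_0\operatorname{Lip}(f)$. Theorem 1.1. Let $X$ be a real Banach space with property $(*)$. Let $Y\subset X$ be a closed linear subspace and $f:Y\to\mathbb R$ a $\mathcal C^1$-smooth function. Then there is a $\mathcal C^1$-smooth function $H:X\to\mathbb R$ with $H|_Y=f$. Furthermore, there is a constant $C$ depending only on $X$ (and not on $Y$ or $f$) such that, if the given $\mathcal C^1$-smooth function $f$ is also Lipschitz on $Y$, then there is a $\mathcal C^1$-smooth and Lipschitz function $H:X\to\mathbb R$ with $H|_Y=f$ and $\operatorname{Lip}(H)\le C\operatorname{Lip}(f)$. -/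

import Mathlib

open scoped NNReal

/-- The Lipschitz constant `Lip(f)` of a Lipschitz function: the least `K ≥ 0` such that
`|f x - f y| ≤ K * dist x y` for all `x`, `y`. It is meaningful only for Lipschitz `f`
(for other `f` it takes the junk value `0`), so it is always used together with the
hypothesis or the conclusion that `f` is Lipschitz. -/
noncomputable def lipConst {E : Type*} [PseudoMetricSpace E] (f : E → ℝ) : ℝ≥0 :=
  sInf {K : ℝ≥0 | LipschitzWith K f}

/-- Property `(*)` of a Banach space `X`: there is a constant `C₀`, depending only on `X`, such
that every Lipschitz function `f : X → ℝ` can be uniformly approximated, to any precision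
`ε > 0`, by a Lipschitz, `C¹`-smooth function `K : X → ℝ` with `Lip(K) ≤ C₀ * Lip(f)`. -/
def PropertyStar (X : Type*) [NormedAddCommGroup X] [NormedSpace ℝ X] : Prop :=
  ∃ C₀ : ℝ≥0, ∀ f : X → ℝ, (∃ L : ℝ≥0, LipschitzWith L f) → ∀ ε : ℝ, 0 < ε →
    ∃ K : X → ℝ, (∃ L : ℝ≥0, LipschitzWith L K) ∧ ContDiff ℝ 1 K ∧
      (∀ x, |f x - K x| < ε) ∧ lipConst K ≤ C₀ * lipConst f

/-!
A `C¹` function on a closed subspace `Y` is extended by successive approximation: find a `C¹`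
function `H₀` on `X` close to `f` on `Y` in value and derivative, do the same for the remainder
`f - H₀|_Y`, and sum. The series converges in `C¹` because an `a`-Lipschitz remainder has an
approximation whose derivative is bounded on all of `X` by a constant multiple of `a`
(`LipApprox.exists_halving`, `LipApprox.exists_extension`).

Approximations are built locally and glued. Property `(*)` provides `C¹` bumps, and these give a
partition of unity made of countably many functions `φₙ` with bounded derivatives, each split into
uniformly separated pieces, one for each member of the cover (`LipApprox.exists_partition`). Local
approximations of a function `g` whose error at level `n` is small against the bound of `φₙ'` then
glue to a `C¹` function close to `g`, whose derivative is nearly a convex combination of the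
derivatives of the local approximations (`LipApprox.exists_glue`).

Gluing is applied twice. Around a point `y ∈ Y`, a Hahn–Banach extension of `f'(y)` plus a smoothed
extension of the remainder, whose Lipschitz constant is small, approximates `f` to first order
along `Y`; the glued function `K` has derivative controlled at the points of `Y`, hence near `Y`,
but not elsewhere (`LipApprox.exists_approx_of_contDiff`). Truncating `K` to a band around a
Lipschitz extension of `K|_Y` gives a globally Lipschitz function equal to `K` near `Y`
(`exists_lipschitzWith_eqOn_nhds`); gluing `K` near `Y` to a smooth approximation of that function
away from `Y` bounds the derivative everywhere (`LipApprox.exists_bounded_fderiv`).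
-/

open scoped NNReal
open Set Filter Topology Metric

/-! ### Lipschitz constants and smooth approximation -/

/-- Property `(*)` with explicit constants: every `L`-Lipschitz function on `X` is, up to any
uniform error, a `(C * L)`-Lipschitz `C¹` function. -/
def LipApprox (X : Type*) [NormedAddCommGroup X] [NormedSpace ℝ X] (C : ℝ≥0) : Prop :=
  ∀ (L : ℝ≥0) (f : X → ℝ), LipschitzWith L f → ∀ ε : ℝ, 0 < ε →
    ∃ K : X → ℝ, ContDiff ℝ 1 K ∧ (∀ x, |f x - K x| < ε) ∧ LipschitzWith (C * L) K

theorem lipConst_le {E : Type*} [PseudoMetricSpace E] {f : E → ℝ} {K : ℝ≥0}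
    (h : LipschitzWith K f) : lipConst f ≤ K :=
  csInf_le (OrderBot.bddBelow _) h

/-- The infimum defining the Lipschitz constant is attained. -/
theorem lipschitzWith_lipConst {E : Type*} [PseudoMetricSpace E] {f : E → ℝ}
    (h : ∃ L : ℝ≥0, LipschitzWith L f) : LipschitzWith (lipConst f) f := by
  refine LipschitzWith.of_dist_le_mul fun x y => ?_
  obtain ⟨L, hL⟩ := h
  rcases (dist_nonneg (x := x) (y := y)).eq_or_lt with h0 | h0
  · have := hL.dist_le_mul x y
    rw [← h0] at this ⊢
    simpa using this
  · rw [← div_le_iff₀ h0]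
    refine Real.toNNReal_le_iff_le_coe.1 (le_csInf ⟨L, hL⟩ fun K hK => ?_)
    exact Real.toNNReal_le_iff_le_coe.2 ((div_le_iff₀ h0).2 (hK.dist_le_mul x y))

theorem PropertyStar.exists_lipApprox {X : Type*} [NormedAddCommGroup X] [NormedSpace ℝ X]
    (h : PropertyStar X) : ∃ C : ℝ≥0, LipApprox X C := by
  obtain ⟨C, hC⟩ := h
  refine ⟨C, fun L f hf ε hε => ?_⟩
  obtain ⟨K, hK, hK1, hKf, hle⟩ := hC f ⟨L, hf⟩ ε hε
  exact ⟨K, hK1, hKf, (lipschitzWith_lipConst hK).weaken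
    (hle.trans (mul_le_mul_right (lipConst_le hf) C))⟩

theorem exists_lipschitzWith_smoothTransition :
    ∃ B : ℝ≥0, LipschitzWith B Real.smoothTransition := by
  have hc : ContDiff ℝ 1 Real.smoothTransition := Real.smoothTransition.contDiff (n := 1)
  have hcomp : HasCompactSupport (deriv Real.smoothTransition) := by
    refine HasCompactSupport.intro (isCompact_Icc (a := (0 : ℝ)) (b := 1)) fun x hx => ?_
    rw [mem_Icc, not_and_or, not_le, not_le] at hx
    rcases hx with hx | hx
    · have : Real.smoothTransition =ᶠ[𝓝 x] fun _ => 0 :=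
        (eventually_lt_nhds hx).mono fun z hz => Real.smoothTransition.zero_of_nonpos hz.le
      simp [this.deriv_eq]
    · have : Real.smoothTransition =ᶠ[𝓝 x] fun _ => 1 :=
        (eventually_gt_nhds hx).mono fun z hz => Real.smoothTransition.one_of_one_le hz.le
      simp [this.deriv_eq]
  obtain ⟨B, hB⟩ := hcomp.exists_bound_of_continuous (hc.continuous_deriv le_rfl)
  refine ⟨B.toNNReal, lipschitzWith_of_nnnorm_deriv_le (hc.differentiable one_ne_zero) fun x => ?_⟩
  rw [← NNReal.coe_le_coe, coe_nnnorm]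
  exact (hB x).trans (Real.le_coe_toNNReal B)

/-! ### Smooth bumps and partitions of unity -/

section

variable {X : Type*} [NormedAddCommGroup X] [NormedSpace ℝ X] {C : ℝ≥0}

/-- A smooth approximation of the distance to `A`, composed with a smooth step, is a `C¹` bump
with bounded derivative around `A`. -/
theorem LipApprox.exists_bump (hX : LipApprox X C) (A : Set X) {ρ : ℝ} (hρ : 0 < ρ) :
    ∃ ψ : X → ℝ, ContDiff ℝ 1 ψ ∧ (∀ x, ψ x ∈ Icc (0 : ℝ) 1) ∧
      (∃ L : ℝ, ∀ x, ‖fderiv ℝ ψ x‖ ≤ L) ∧ (∀ x ∈ thickening ρ A, ψ x = 1) ∧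
      ∀ x ∉ thickening (2 * ρ) A, ψ x = 0 := by
  rcases A.eq_empty_or_nonempty with rfl | hA
  · exact ⟨fun _ => 0, contDiff_const, by simp, ⟨0, by simp⟩, by simp, by simp⟩
  obtain ⟨k, hk, hkd, hkL⟩ := hX 1 (fun x => infDist x A) (lipschitz_infDist_pt A) (ρ / 4)
    (by positivity)
  obtain ⟨B, hB⟩ := exists_lipschitzWith_smoothTransition
  -- The step rises from `0` to `1` as `k` falls from `7ρ/4` to `5ρ/4`.
  have hstep : LipschitzWith (2 / ρ).toNNReal fun t : ℝ => (7 / 4 * ρ - t) / (ρ / 2) := by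
    refine LipschitzWith.of_dist_le_mul fun s t => le_of_eq ?_
    rw [Real.coe_toNNReal _ (by positivity), Real.dist_eq, Real.dist_eq, ← sub_div, abs_div,
      abs_of_pos (half_pos hρ), sub_sub_sub_cancel_left, abs_sub_comm]
    field_simp
  refine ⟨fun x => Real.smoothTransition ((7 / 4 * ρ - k x) / (ρ / 2)), ?_, fun x =>
    ⟨Real.smoothTransition.nonneg _, Real.smoothTransition.le_one _⟩,
    ⟨_, fun x => norm_fderiv_le_of_lipschitz ℝ (hB.comp (hstep.comp hkL))⟩, fun x hx => ?_,
    fun x hx => ?_⟩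
  · exact (Real.smoothTransition.contDiff (n := 1)).comp ((contDiff_const.sub hk).div_const _)
  · have h1 : infDist x A < ρ := by
      obtain ⟨a, ha, hxa⟩ := mem_thickening_iff.1 hx
      exact (infDist_le_dist_of_mem ha).trans_lt hxa
    have h2 := (abs_lt.1 (hkd x)).1
    apply Real.smoothTransition.one_of_one_le
    rw [le_div_iff₀ (by positivity)]
    linarith
  · have h1 : 2 * ρ ≤ infDist x A := by
      by_contra! h
      obtain ⟨a, ha, hxa⟩ := (infDist_lt_iff hA).1 h
      exact hx (mem_thickening_iff.2 ⟨a, ha, hxa⟩)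
    have h2 := (abs_lt.1 (hkd x)).2
    apply Real.smoothTransition.zero_of_nonpos
    exact div_nonpos_of_nonpos_of_nonneg (by linarith) (by positivity)

theorem norm_fderiv_mul_le_add {a b : X → ℝ} {A B : ℝ} {x : X} (ha : DifferentiableAt ℝ a x)
    (hb : DifferentiableAt ℝ b x) (ha1 : a x ∈ Icc (0 : ℝ) 1) (hb1 : b x ∈ Icc (0 : ℝ) 1)
    (hA : ‖fderiv ℝ a x‖ ≤ A) (hB : ‖fderiv ℝ b x‖ ≤ B) :
    ‖fderiv ℝ (fun z => a z * b z) x‖ ≤ A + B := by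
  rw [fderiv_fun_mul ha hb]
  refine (norm_add_le _ _).trans ?_
  rw [norm_smul, norm_smul, Real.norm_of_nonneg ha1.1, Real.norm_of_nonneg hb1.1, add_comm]
  exact add_le_add ((mul_le_of_le_one_left (norm_nonneg _) hb1.2).trans hA)
    ((mul_le_of_le_one_left (norm_nonneg _) ha1.2).trans hB)

/-- A `C¹` partition of unity `φ` subordinate to an open cover, arranged in countably many levels.
Near each point the level function `φ n` is either zero or supported by the single member
`U (σ n x)` of the cover, and the derivative of `φ n` is bounded on all of `X`: hence prescribed
errors at level `n`, uniform over the possibly uncountable cover, can be summed. -/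
theorem LipApprox.exists_partition (hX : LipApprox X C) {ι : Type*} (U : ι → Set X)
    (hU : ∀ i, IsOpen (U i)) (hcov : ∀ x, ∃ i, x ∈ U i) :
    ∃ (φ : ℕ → X → ℝ) (σ : ℕ → X → ι) (Λ : ℕ → ℝ),
      (∀ n, ContDiff ℝ 1 (φ n)) ∧ (∀ n x, 0 ≤ φ n x) ∧ (∀ n x, ‖fderiv ℝ (φ n) x‖ ≤ Λ n) ∧
      (∀ n x, (∀ᶠ z in 𝓝 x, φ n z = 0) ∨
        (x ∈ U (σ n x) ∧ ∀ᶠ z in 𝓝 x, σ n z = σ n x)) ∧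
      ∀ x, ∃ N, ∀ᶠ z in 𝓝 x,
        ∑ n ∈ Finset.range N, φ n z = 1 ∧ ∀ n, N ≤ n → φ n z = 0 := by
  classical
  obtain ⟨i₀, -⟩ := hcov 0
  obtain ⟨_, _⟩ := exists_wellFoundedLT ι
  let ρ : ℕ → ℝ := fun n => 1 / ((n : ℝ) + 1)
  have hρ : ∀ n, 0 < ρ n := fun n => Nat.one_div_pos_of_nat
  -- Points at least `ρ n` deep in `U i` that lie in no earlier member of the cover.
  let A : ℕ → ι → Set X := fun n i => {x | ball x (ρ n) ⊆ U i ∧ ∀ j < i, x ∉ U j}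
  have hsep : ∀ n i j, i ≠ j → ∀ x ∈ A n i, ∀ y ∈ A n j, ρ n ≤ dist x y := by
    intro n i j hij x hx y hy
    by_contra! h
    rcases lt_or_gt_of_ne hij with hlt | hlt
    · exact hy.2 i hlt (hx.1 (mem_ball'.2 h))
    · exact hx.2 j hlt (hy.1 (mem_ball.2 h))
  have hAcov : ∀ x, ∃ n i, x ∈ A n i := by
    intro x
    obtain ⟨i, hi, hmin⟩ := WellFounded.has_min (wellFounded_lt (α := ι)) {i | x ∈ U i} (hcov x)
    obtain ⟨r, hr, hball⟩ := Metric.isOpen_iff.1 (hU i) x hi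
    obtain ⟨n, hn⟩ := exists_nat_one_div_lt hr
    exact ⟨n, i, (ball_subset_ball hn.le).trans hball, fun j hj hxj => hmin j hxj hj⟩
  let O : ℕ → ι → Set X := fun n i => thickening (ρ n / 2) (A n i)
  have hOU : ∀ n i, O n i ⊆ U i := by
    intro n i x hx
    obtain ⟨a, ha, hxa⟩ := mem_thickening_iff.1 hx
    exact ha.1 (mem_ball.2 (hxa.trans (half_lt_self (hρ n))))
  have hOuniq : ∀ n i j x, x ∈ O n i → x ∈ O n j → i = j := by
    intro n i j x hi hj
    by_contra hij
    obtain ⟨a, ha, hxa⟩ := mem_thickening_iff.1 hi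
    obtain ⟨b, hb, hxb⟩ := mem_thickening_iff.1 hj
    have := hsep n i j hij a ha b hb
    have := dist_triangle_left a b x
    linarith
  let σ : ℕ → X → ι := fun n x => if h : ∃ i, x ∈ O n i then h.choose else i₀
  have hσ : ∀ n i x, x ∈ O n i → σ n x = i := by
    intro n i x hx
    have h : ∃ i, x ∈ O n i := ⟨i, hx⟩
    simp only [σ, dif_pos h]
    exact hOuniq n _ _ x h.choose_spec hx
  choose ψ hψ hψI hψL hψ1 hψ0 using fun n =>
    hX.exists_bump (⋃ i, A n i) (ρ := ρ n / 8) (by have := hρ n; positivity)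
  choose L hL using hψL
  let P : ℕ → X → ℝ := fun n x => ∏ m ∈ Finset.range n, (1 - ψ m x)
  have hPs : ∀ n x, P (n + 1) x = P n x * (1 - ψ n x) := fun n x => Finset.prod_range_succ _ _
  have hψ' : ∀ n x, 1 - ψ n x ∈ Icc (0 : ℝ) 1 := fun n x =>
    ⟨by linarith [(hψI n x).2], by linarith [(hψI n x).1]⟩
  have hPd : ∀ n, ContDiff ℝ 1 (P n) := fun n =>
    contDiff_prod fun m _ => contDiff_const.sub (hψ m)
  have hPI : ∀ n x, P n x ∈ Icc (0 : ℝ) 1 := fun n x =>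
    ⟨Finset.prod_nonneg fun m _ => (hψ' m x).1,
      Finset.prod_le_one (fun m _ => (hψ' m x).1) fun m _ => (hψ' m x).2⟩
  have hPL : ∀ n, ∃ B : ℝ, ∀ x, ‖fderiv ℝ (P n) x‖ ≤ B := by
    intro n
    induction n with
    | zero => exact ⟨0, fun x => by simp [P]⟩
    | succ n ih =>
      obtain ⟨B, hB⟩ := ih
      refine ⟨B + L n, fun x => ?_⟩
      rw [show P (n + 1) = fun x => P n x * (1 - ψ n x) from funext (hPs n)]
      refine norm_fderiv_mul_le_add ((hPd n).differentiable one_ne_zero x)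
        ((contDiff_const.sub (hψ n)).differentiable one_ne_zero x) (hPI n x) (hψ' n x) (hB x) ?_
      rw [fderiv_const_sub, norm_neg]
      exact hL n x
  choose B hB using hPL
  have hsum : ∀ N x, ∑ n ∈ Finset.range N, P n x * ψ n x = 1 - P N x := by
    intro N x
    induction N with
    | zero => simp [P]
    | succ N ih => rw [Finset.sum_range_succ, ih, hPs]; ring
  refine ⟨fun n x => P n x * ψ n x, σ, fun n => B n + L n, fun n => (hPd n).mul (hψ n),
    fun n x => mul_nonneg (hPI n x).1 (hψI n x).1, fun n x => norm_fderiv_mul_le_add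
      ((hPd n).differentiable one_ne_zero x) ((hψ n).differentiable one_ne_zero x)
      (hPI n x) (hψI n x) (hB n x) (hL n x), fun n x => ?_, fun x => ?_⟩
  · by_cases h : ∃ i, x ∈ O n i
    · right
      obtain ⟨i, hi⟩ := h
      rw [hσ n i x hi]
      exact ⟨hOU n i hi, (isOpen_thickening.eventually_mem hi).mono fun z hz => hσ n i z hz⟩
    · left
      filter_upwards [ball_mem_nhds x (show 0 < ρ n / 4 by have := hρ n; positivity)] with z hz
      rw [hψ0 n z, mul_zero]
      intro hz'
      obtain ⟨a, ha, hza⟩ := mem_thickening_iff.1 hz'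
      obtain ⟨i, hi⟩ := mem_iUnion.1 ha
      refine h ⟨i, mem_thickening_iff.2 ⟨a, hi, ?_⟩⟩
      have := dist_triangle_left x a z
      have := mem_ball.1 hz
      linarith
  · obtain ⟨n, i, hi⟩ := hAcov x
    have hmem : x ∈ thickening (ρ n / 8) (⋃ i, A n i) :=
      self_subset_thickening (by have := hρ n; positivity) _ (mem_iUnion.2 ⟨i, hi⟩)
    refine ⟨n + 1, (isOpen_thickening.eventually_mem hmem).mono fun z hz => ?_⟩
    have hP0 : ∀ m, n + 1 ≤ m → P m z = 0 := fun m hm =>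
      Finset.prod_eq_zero (Finset.mem_range.2 hm) (by rw [hψ1 n z hz, sub_self])
    exact ⟨by rw [hsum, hP0 _ le_rfl, sub_zero], fun m hm => mul_eq_zero_of_left (hP0 m hm) _⟩

/-! ### Gluing local approximations -/

/-- Gluing of local approximations. Suppose that on each member `U i` of an open cover the
function `g` has, to any precision on `U i ∩ S`, an approximation `k`, `C¹` on `U i`, whose
derivative at each `x ∈ U i ∩ S` lies in the convex set `Q x`. Then `g` has a global `C¹`
approximation on `S` whose derivatives almost lie in the sets `Q x`. No regularity of `g` is
needed: since `∑ φₙ' = 0`, the terms `kₙ φₙ'` of the derivative add up to `∑ (kₙ - g x) φₙ'`. -/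
theorem LipApprox.exists_glue (hX : LipApprox X C) {ι : Type*} (U : ι → Set X)
    (hU : ∀ i, IsOpen (U i)) (hcov : ∀ x, ∃ i, x ∈ U i) (S : Set X) (g : X → ℝ)
    (Q : X → Set (X →L[ℝ] ℝ)) (hQ : ∀ x, Convex ℝ (Q x))
    (hloc : ∀ i, ∀ η : ℝ, 0 < η → ∃ k : X → ℝ, (∀ x ∈ U i, ContDiffAt ℝ 1 k x) ∧
      ∀ x ∈ U i ∩ S, |k x - g x| ≤ η ∧ fderiv ℝ k x ∈ Q x)
    {ε : ℝ} (hε : 0 < ε) :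
    ∃ K : X → ℝ, ContDiff ℝ 1 K ∧ ∀ x ∈ S, |K x - g x| ≤ ε ∧
      ∃ T ∈ Q x, ‖fderiv ℝ K x - T‖ ≤ ε := by
  obtain ⟨φ, σ, Λ, hφ, hφ0, hφL, hσ, hfin⟩ := hX.exists_partition U hU hcov
  have hΛ : ∀ n, 0 ≤ Λ n := fun n => (norm_nonneg _).trans (hφL n 0)
  -- At level `n` the error times the bound `Λ n` of the derivative is at most `ε / 2 ^ (n + 1)`.
  have hη : ∀ n, 0 < ε / 2 / 2 ^ n / (Λ n + 1) := fun n => by have := hΛ n; positivity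
  choose k hk hkS using fun n i => hloc i _ (hη n)
  -- Each level is a product of `C¹` functions near every point where it does not vanish locally.
  have hterm : ∀ n x, ContDiffAt ℝ 1 (fun z => φ n z * k n (σ n z) z) x ∧
      HasFDerivAt (fun z => φ n z * k n (σ n z) z)
        (φ n x • fderiv ℝ (k n (σ n x)) x + k n (σ n x) x • fderiv ℝ (φ n) x) x := by
    intro n x
    rcases hσ n x with h | ⟨hxU, h⟩
    · have h1 : (fun z => φ n z * k n (σ n z) z) =ᶠ[𝓝 x] fun _ => (0 : ℝ) :=
        h.mono fun z hz => by simp [hz]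
      have h2 : φ n =ᶠ[𝓝 x] fun _ => (0 : ℝ) := h
      refine ⟨contDiffAt_const.congr_of_eventuallyEq h1, ?_⟩
      rw [h2.fderiv_eq, h2.self_of_nhds]
      simpa using (hasFDerivAt_const (0 : ℝ) x).congr_of_eventuallyEq h1
    · have h1 : (fun z => φ n z * k n (σ n z) z) =ᶠ[𝓝 x] fun z => φ n z * k n (σ n x) z :=
        h.mono fun z hz => by simp only [hz]
      have hkx := hk n (σ n x) x hxU
      exact ⟨((hφ n).contDiffAt.mul hkx).congr_of_eventuallyEq h1,
        (((hφ n).differentiable one_ne_zero x).hasFDerivAt.mul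
          (hkx.differentiableAt one_ne_zero).hasFDerivAt).congr_of_eventuallyEq h1⟩
  have hbound : ∀ n x, x ∈ S → φ n x ≠ 0 →
      |k n (σ n x) x - g x| ≤ ε / 2 / 2 ^ n / (Λ n + 1) ∧ fderiv ℝ (k n (σ n x)) x ∈ Q x := by
    intro n x hxS hne
    rcases hσ n x with h | ⟨hxU, -⟩
    · exact absurd h.self_of_nhds hne
    · exact hkS n _ x ⟨hxU, hxS⟩
  have hgeom : ∀ N, ∑ n ∈ Finset.range N, ε / 2 / 2 ^ n ≤ ε := fun N =>
    (summable_geometric_two' ε).sum_le_tsum _ (fun n _ => by positivity) |>.trans_eq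
      (tsum_geometric_two' ε)
  let K : X → ℝ := fun x => ∑ᶠ n, φ n x * k n (σ n x) x
  have hK : ∀ N x, (∀ n, N ≤ n → φ n x = 0) →
      K x = ∑ n ∈ Finset.range N, φ n x * k n (σ n x) x := by
    intro N x h
    refine finsum_eq_sum_of_support_subset _ fun n hn => ?_
    rw [Finset.coe_range, mem_Iio]
    by_contra! hle
    exact hn (by simp [h n hle])
  refine ⟨K, contDiff_iff_contDiffAt.2 fun x => ?_, fun x hxS => ?_⟩
  · obtain ⟨N, hN⟩ := hfin x
    exact (ContDiffAt.sum fun n _ => (hterm n x).1).congr_of_eventuallyEq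
      (hN.mono fun z hz => hK N z hz.2)
  obtain ⟨N, hN⟩ := hfin x
  have h1 := hN.self_of_nhds.1
  constructor
  · rw [hK N x hN.self_of_nhds.2]
    have : ∑ n ∈ Finset.range N, φ n x * k n (σ n x) x - g x =
        ∑ n ∈ Finset.range N, φ n x * (k n (σ n x) x - g x) := by
      simp only [mul_sub, Finset.sum_sub_distrib, ← Finset.sum_mul, h1, one_mul]
    rw [this]
    refine (Finset.abs_sum_le_sum_abs _ _).trans ?_
    calc ∑ n ∈ Finset.range N, |φ n x * (k n (σ n x) x - g x)|
        ≤ ∑ n ∈ Finset.range N, φ n x * ε := by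
          refine Finset.sum_le_sum fun n _ => ?_
          rw [abs_mul, abs_of_nonneg (hφ0 n x)]
          by_cases hne : φ n x = 0
          · simp [hne]
          refine mul_le_mul_of_nonneg_left ((hbound n x hxS hne).1.trans ?_) (hφ0 n x)
          have h2 : (1 : ℝ) ≤ 2 ^ n := one_le_pow₀ one_le_two
          have := hΛ n
          refine (div_le_self (by positivity) (by linarith)).trans ?_
          exact (div_le_self (by positivity) h2).trans (by linarith)
      _ = ε := by rw [← Finset.sum_mul, h1, one_mul]
  · have hder : fderiv ℝ K x = ∑ n ∈ Finset.range N,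
        (φ n x • fderiv ℝ (k n (σ n x)) x + k n (σ n x) x • fderiv ℝ (φ n) x) :=
      ((HasFDerivAt.fun_sum fun n _ => (hterm n x).2).congr_of_eventuallyEq
        (hN.mono fun z hz => hK N z hz.2)).fderiv
    have hzero : ∑ n ∈ Finset.range N, fderiv ℝ (φ n) x = 0 := by
      have ha : HasFDerivAt (fun z => ∑ n ∈ Finset.range N, φ n z)
          (∑ n ∈ Finset.range N, fderiv ℝ (φ n) x) x :=
        HasFDerivAt.fun_sum fun n _ => ((hφ n).differentiable one_ne_zero x).hasFDerivAt
      exact ha.unique ((hasFDerivAt_const (1 : ℝ) x).congr_of_eventuallyEq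
        (hN.mono fun z hz => hz.1))
    refine ⟨∑ n ∈ Finset.range N, φ n x • fderiv ℝ (k n (σ n x)) x, ?_, ?_⟩
    · have hsub : ∀ n ∈ Finset.range N, n ∉ (Finset.range N).filter (fun n => φ n x ≠ 0) →
          φ n x = 0 := fun n hn hn' => by
        by_contra hne
        exact hn' (Finset.mem_filter.2 ⟨hn, hne⟩)
      rw [← Finset.sum_subset (Finset.filter_subset (fun n => φ n x ≠ 0) _)
        fun n hn hn' => by rw [hsub n hn hn', zero_smul]]
      refine (hQ x).sum_mem (fun n _ => hφ0 n x) ?_ fun n hn =>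
        (hbound n x hxS (Finset.mem_filter.1 hn).2).2
      rw [Finset.sum_subset (Finset.filter_subset (fun n => φ n x ≠ 0) _) hsub, h1]
    · have : fderiv ℝ K x - ∑ n ∈ Finset.range N, φ n x • fderiv ℝ (k n (σ n x)) x =
          ∑ n ∈ Finset.range N, (k n (σ n x) x - g x) • fderiv ℝ (φ n) x := by
        simp only [sub_smul, Finset.sum_sub_distrib, ← Finset.smul_sum, hzero, smul_zero, sub_zero,
          hder, Finset.sum_add_distrib, add_sub_cancel_left]
      rw [this]
      refine (norm_sum_le _ _).trans ((Finset.sum_le_sum fun n _ => ?_).trans (hgeom N))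
      by_cases hne : φ n x = 0
      · -- A nonnegative function has zero derivative where it vanishes.
        have hmin : IsLocalMin (φ n) x := Eventually.of_forall fun z => hne ▸ hφ0 n z
        rw [hmin.fderiv_eq_zero, smul_zero, norm_zero]
        positivity
      · rw [norm_smul, Real.norm_eq_abs]
        have hpos : 0 < Λ n + 1 := by linarith [hΛ n]
        calc _ ≤ ε / 2 / 2 ^ n / (Λ n + 1) * (Λ n + 1) :=
              mul_le_mul (hbound n x hxS hne).1 ((hφL n x).trans (by linarith)) (norm_nonneg _)
                (hη n).le
          _ = _ := div_mul_cancel₀ _ hpos.ne'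

/-! ### First-order approximation along a closed subspace -/

theorem exists_lipschitzWith_extend {E : Type*} [PseudoMetricSpace E] {p : E → Prop}
    {u : Subtype p → ℝ} {s : Set (Subtype p)} {L : ℝ≥0} (h : LipschitzOnWith L u s) :
    ∃ F : E → ℝ, LipschitzWith L F ∧ ∀ y ∈ s, F y = u y := by
  have hext : ∀ y : Subtype p, Function.extend Subtype.val u 0 (y : E) = u y := fun y =>
    Subtype.val_injective.extend_apply u 0 y
  have : LipschitzOnWith L (Function.extend Subtype.val u 0) (Subtype.val '' s) := by
    rintro _ ⟨y, hy, rfl⟩ _ ⟨z, hz, rfl⟩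
    rw [hext, hext]
    exact h hy hz
  obtain ⟨F, hF, hFe⟩ := this.extend_real
  exact ⟨F, hF, fun y hy => (hFe (mem_image_of_mem _ hy)).symm.trans (hext y)⟩

theorem convex_norm_comp_sub_le_and_norm_le {E : Type*} [NormedAddCommGroup E] [NormedSpace ℝ E]
    (J : E →L[ℝ] X) (D : E →L[ℝ] ℝ) (r R : ℝ) :
    Convex ℝ {T : X →L[ℝ] ℝ | ‖T.comp J - D‖ ≤ r ∧ ‖T‖ ≤ R} := by
  have h1 := (convex_closedBall D r).is_linear_preimage (f := fun T : X →L[ℝ] ℝ => T.comp J)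
    ⟨fun _ _ => ContinuousLinearMap.add_comp _ _ _, fun _ _ => ContinuousLinearMap.smul_comp _ _ _⟩
  have h2 : {T : X →L[ℝ] ℝ | ‖T.comp J - D‖ ≤ r ∧ ‖T‖ ≤ R} =
      (fun T : X →L[ℝ] ℝ => T.comp J) ⁻¹' closedBall D r ∩ closedBall 0 R := by
    ext T
    rw [mem_inter_iff, mem_preimage, mem_closedBall, mem_closedBall_zero_iff, dist_eq_norm]
    rfl
  rw [h2]
  exact h1.inter (convex_closedBall _ _)

/-- A `C¹` function on a closed subspace is approximated, together with its derivative, by a `C¹`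
function on the whole space whose derivative at points of `Y` is hardly larger than that of `f`.
Near `y ∈ Y` the approximation is a norm-preserving extension of `fderiv ℝ f y` plus a smooth
approximation of a Lipschitz extension of the remainder, whose Lipschitz constant is small. -/
theorem LipApprox.exists_approx_of_contDiff (hX : LipApprox X C) (Y : Submodule ℝ X)
    (hY : IsClosed (Y : Set X)) {f : Y → ℝ} (hf : ContDiff ℝ 1 f) {ε : ℝ} (hε : 0 < ε) :
    ∃ K : X → ℝ, ContDiff ℝ 1 K ∧ ∀ y : Y, |K y - f y| ≤ ε ∧
      ‖(fderiv ℝ K y).comp Y.subtypeL - fderiv ℝ f y‖ ≤ ε ∧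
      ‖fderiv ℝ K y‖ ≤ ‖fderiv ℝ f y‖ + ε := by
  -- The remainder has Lipschitz constant `e`, and its smooth approximation `C * e`.
  let e : ℝ≥0 := (ε / 2 / (C + 1)).toNNReal
  have hC : (0 : ℝ) < C + 1 := by positivity
  have he : (e : ℝ) = ε / 2 / (C + 1) := Real.coe_toNNReal _ (by positivity)
  have hepos : (0 : ℝ) < e := by rw [he]; positivity
  have hCe : (C : ℝ) * e + e = ε / 2 := by rw [he]; field_simp
  have hfd : Differentiable ℝ f := hf.differentiable one_ne_zero
  let g : X → ℝ := Function.extend Subtype.val f 0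
  have hg : ∀ y : Y, g y = f y := fun y => Subtype.val_injective.extend_apply f 0 y
  let D : X → Y →L[ℝ] ℝ := Function.extend Subtype.val (fderiv ℝ f) 0
  have hD : ∀ y : Y, D y = fderiv ℝ f y := fun y =>
    Subtype.val_injective.extend_apply (fderiv ℝ f) 0 y
  have hr : ∀ y : Y, ∃ r > 0, ∀ z ∈ ball y r, ‖fderiv ℝ f z - fderiv ℝ f y‖ < e := by
    intro y
    obtain ⟨r, hr, h⟩ := Metric.continuous_iff.1 (hf.continuous_fderiv one_ne_zero) y e hepos
    exact ⟨r, hr, fun z hz => (dist_eq_norm _ _).symm.trans_lt (h z hz)⟩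
  choose r hr0 hr using hr
  let U : Option Y → Set X := fun o => o.elim (Y : Set X)ᶜ fun y => ball (y : X) (r y)
  let Q : X → Set (X →L[ℝ] ℝ) := fun x =>
    {T | ‖T.comp Y.subtypeL - D x‖ ≤ ε / 2 ∧ ‖T‖ ≤ ‖D x‖ + ε / 2}
  have hQ : ∀ x, Convex ℝ (Q x) := fun x => convex_norm_comp_sub_le_and_norm_le _ _ _ _
  have hloc : ∀ i, ∀ η : ℝ, 0 < η → ∃ k : X → ℝ, (∀ x ∈ U i, ContDiffAt ℝ 1 k x) ∧
      ∀ x ∈ U i ∩ (Y : Set X), |k x - g x| ≤ η ∧ fderiv ℝ k x ∈ Q x := by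
    rintro (_ | y) η hη
    · exact ⟨fun _ => 0, fun _ _ => contDiffAt_const, fun x hx => absurd hx.2 hx.1⟩
    have hu : LipschitzOnWith e (fun z => f z - fderiv ℝ f y z) (ball y (r y)) := by
      refine Convex.lipschitzOnWith_of_nnnorm_fderiv_le (𝕜 := ℝ)
        (fun z _ => (hfd z).sub (fderiv ℝ f y).differentiableAt) (fun z hz => ?_)
        (convex_ball _ _)
      rw [fderiv_fun_sub (hfd z) (fderiv ℝ f y).differentiableAt, ContinuousLinearMap.fderiv,
        ← NNReal.coe_le_coe, coe_nnnorm]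
      exact (hr y z hz).le
    obtain ⟨F, hF, hFu⟩ := exists_lipschitzWith_extend hu
    obtain ⟨k, hk, hkF, hkL⟩ := hX e F hF η hη
    obtain ⟨T, hT, hTn⟩ := exists_extension_norm_eq Y (fderiv ℝ f y)
    refine ⟨fun x => T x + k x, fun x _ => (T.contDiff.add hk).contDiffAt, ?_⟩
    rintro x ⟨hxU, hxY⟩
    have hz : (⟨x, hxY⟩ : Y) ∈ ball y (r y) := hxU
    have hk' : ‖fderiv ℝ k x‖ ≤ C * e := norm_fderiv_le_of_lipschitz ℝ hkL
    have hclose := hr y _ hz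
    have hgx : g x = f ⟨x, hxY⟩ := hg ⟨x, hxY⟩
    have hDx : D x = fderiv ℝ f ⟨x, hxY⟩ := hD ⟨x, hxY⟩
    have hder : fderiv ℝ (fun x => T x + k x) x = T + fderiv ℝ k x := by
      rw [fderiv_fun_add T.differentiableAt (hk.differentiable one_ne_zero x),
        ContinuousLinearMap.fderiv]
    have hTY : T.comp Y.subtypeL = fderiv ℝ f y := ContinuousLinearMap.ext hT
    refine ⟨?_, ?_, ?_⟩
    · have h1 := (hkF x).le
      have h2 : F x = f ⟨x, hxY⟩ - fderiv ℝ f y ⟨x, hxY⟩ := hFu _ hz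
      have h3 : T x = fderiv ℝ f y ⟨x, hxY⟩ := hT ⟨x, hxY⟩
      rw [abs_sub_comm, h2] at h1
      rw [hgx]
      have h4 : T x + k x - f ⟨x, hxY⟩ = k x - (f ⟨x, hxY⟩ - fderiv ℝ f y ⟨x, hxY⟩) := by
        rw [h3]
        ring
      exact (congrArg abs h4).trans_le h1
    · rw [hder, hDx, ContinuousLinearMap.add_comp, hTY, add_sub_right_comm]
      have h2 : ‖(fderiv ℝ k x).comp Y.subtypeL‖ ≤ C * e :=
        (ContinuousLinearMap.opNorm_comp_le _ _).trans
          ((mul_le_of_le_one_right (norm_nonneg _) Y.norm_subtypeL_le).trans hk')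
      have hclose' : ‖fderiv ℝ f y - fderiv ℝ f ⟨x, hxY⟩‖ < e :=
        (norm_sub_rev (fderiv ℝ f y) (fderiv ℝ f ⟨x, hxY⟩)).trans_lt hclose
      have h3 := norm_add_le (fderiv ℝ f y - fderiv ℝ f ⟨x, hxY⟩) ((fderiv ℝ k x).comp Y.subtypeL)
      exact h3.trans (by linarith)
    · rw [hder, hDx]
      have h2 := norm_le_norm_add_norm_sub (fderiv ℝ f ⟨x, hxY⟩) (fderiv ℝ f y)
      have h3 := norm_add_le T (fderiv ℝ k x)
      exact h3.trans (by linarith)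
  obtain ⟨K, hK, hKS⟩ := hX.exists_glue U (fun o => by
      cases o with
      | none => exact hY.isOpen_compl
      | some y => exact isOpen_ball)
    (fun x => by
      by_cases hx : x ∈ Y
      · exact ⟨some ⟨x, hx⟩, mem_ball_self (hr0 _)⟩
      · exact ⟨none, hx⟩) (Y : Set X) g Q hQ hloc (half_pos hε)
  refine ⟨K, hK, fun y => ?_⟩
  obtain ⟨h1, T, ⟨hT1, hT2⟩, hT⟩ := hKS y y.2
  rw [hg] at h1
  rw [hD] at hT1 hT2
  refine ⟨by linarith, ?_, ?_⟩
  · have h2 : ‖(fderiv ℝ K y - T).comp Y.subtypeL‖ ≤ ε / 2 :=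
      (ContinuousLinearMap.opNorm_comp_le _ _).trans
        ((mul_le_of_le_one_right (norm_nonneg _) Y.norm_subtypeL_le).trans hT)
    have h3 := norm_add_le ((fderiv ℝ K y - T).comp Y.subtypeL)
      (T.comp Y.subtypeL - fderiv ℝ f y)
    rw [ContinuousLinearMap.sub_comp, sub_add_sub_cancel] at h3
    rw [ContinuousLinearMap.sub_comp] at h2
    linarith
  · have := norm_le_norm_add_norm_sub' (fderiv ℝ K y) T
    linarith

/-! ### Bounding the derivative away from the subspace -/

/-- If `K` is `C¹` with derivative smaller than `M` at the points of the closed subspace `Y`, then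
some globally `2M`-Lipschitz function coincides with `K` near `Y`. It is `K` truncated to the band
`[F - w, F + w]` around an `M`-Lipschitz extension `F` of `K|_Y`, where the width `w` is `M` times
the distance to the set on which the derivative of `K` is large. -/
theorem exists_lipschitzWith_eqOn_nhds (Y : Submodule ℝ X) {K : X → ℝ} (hK : ContDiff ℝ 1 K)
    {M : ℝ≥0} (hM : ∀ y ∈ Y, ‖fderiv ℝ K y‖ < M) :
    ∃ (g : X → ℝ) (V : Set X), LipschitzWith (2 * M) g ∧ IsOpen V ∧ (Y : Set X) ⊆ V ∧
      ∀ x ∈ V, g x = K x ∧ ‖fderiv ℝ K x‖ ≤ M := by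
  have hKd : Differentiable ℝ K := hK.differentiable one_ne_zero
  have hKlip : ∀ s : Set X, Convex ℝ s → (∀ x ∈ s, ‖fderiv ℝ K x‖ < M) → LipschitzOnWith M K s :=
    fun s hs h => hs.lipschitzOnWith_of_nnnorm_fderiv_le (𝕜 := ℝ) (fun x _ => hKd x) fun x hx => by
      rw [← NNReal.coe_le_coe, coe_nnnorm]
      exact (h x hx).le
  let U : Set X := {x | ‖fderiv ℝ K x‖ < M}
  have hU : IsOpen U := isOpen_lt (hK.continuous_fderiv one_ne_zero).norm continuous_const
  -- This case is separate because the distance to the empty set is `0` by convention.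
  rcases Uᶜ.eq_empty_or_nonempty with hUe | hUne
  · have hUall : ∀ x, ‖fderiv ℝ K x‖ < M := fun x => by
      have : x ∈ U := by rw [compl_empty_iff.1 hUe]; trivial
      exact this
    refine ⟨K, univ, (lipschitzOnWith_univ.1 (hKlip univ convex_univ fun x _ => hUall x)).weaken ?_,
      isOpen_univ, subset_univ _, fun x _ => ⟨rfl, (hUall x).le⟩⟩
    exact le_mul_of_one_le_left zero_le one_le_two
  obtain ⟨F, hF, hFK⟩ := (hKlip Y Y.convex hM).extend_real
  let w : X → ℝ := fun x => M * infDist x Uᶜ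
  have hw0 : ∀ x, 0 ≤ w x := fun x => mul_nonneg M.2 infDist_nonneg
  have hwc : Continuous w := continuous_const.mul (continuous_infDist_pt _)
  have hwz : ∀ x, ∀ z ∉ U, w x ≤ M * dist x z := fun x z hz =>
    mul_le_mul_of_nonneg_left (infDist_le_dist_of_mem hz) M.2
  have hwl : ∀ x y, |w x - w y| ≤ M * dist x y := fun x y => by
    rw [← mul_sub, abs_mul, NNReal.abs_eq]
    exact mul_le_mul_of_nonneg_left ((lipschitz_infDist_pt _).dist_le_mul x y |>.trans_eq
      (by simp)) M.2
  have hFl : ∀ x y, |F x - F y| ≤ M * dist x y := fun x y => hF.dist_le_mul x y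
  let g : X → ℝ := fun x => max (F x - w x) (min (K x) (F x + w x))
  have hgF : ∀ x, |g x - F x| ≤ w x := by
    intro x
    have := hw0 x
    refine abs_le.2 ⟨by linarith [le_max_left (F x - w x) (min (K x) (F x + w x))], ?_⟩
    have : g x ≤ F x + w x := max_le (by linarith) (min_le_right _ _)
    linarith
  refine ⟨g, U ∩ {x | |K x - F x| < w x}, LipschitzWith.of_dist_le_mul fun x y => ?_,
    hU.inter (isOpen_lt (hK.continuous.sub hF.continuous).abs hwc), fun y hy => ⟨hM y hy, ?_⟩, ?_⟩
  · have hFxy := hFl x y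
    push_cast
    rw [Real.dist_eq]
    -- Inside `U` all three ingredients are Lipschitz along the segment; if the segment leaves `U`
    -- at `z`, the width of the band at its ends is controlled by the distances to `z`.
    by_cases hseg : segment ℝ x y ⊆ U
    · have hKxy : |K x - K y| ≤ 2 * M * dist x y :=
        ((hKlip _ (convex_segment x y) hseg).dist_le_mul x (left_mem_segment ℝ x y) y
          (right_mem_segment ℝ x y)).trans (by
            have : 0 ≤ M * dist x y := by positivity
            linarith)
      have hwxy := hwl x y
      have h1 : |F x - w x - (F y - w y)| ≤ 2 * M * dist x y := by
        rw [abs_le] at *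
        constructor <;> linarith
      have h2 : |F x + w x - (F y + w y)| ≤ 2 * M * dist x y := by
        rw [abs_le] at *
        constructor <;> linarith
      exact (abs_max_sub_max_le_max _ _ _ _).trans
        (max_le h1 ((abs_min_sub_min_le_max _ _ _ _).trans (max_le hKxy h2)))
    · obtain ⟨z, hz, hzU⟩ := not_subset.1 hseg
      have hd := dist_add_dist_of_mem_segment hz
      have h1 := (hgF x).trans (hwz x z hzU)
      have h2 := (hgF y).trans (hwz y z hzU)
      rw [dist_comm y z] at h2
      have h3 : (M : ℝ) * dist x z + M * dist z y = M * dist x y := by rw [← mul_add, hd]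
      rw [abs_le] at *
      constructor <;> linarith
  · rw [mem_ofPred_eq, ← hFK hy, sub_self, abs_zero]
    have hMpos : (0 : ℝ) < M := (norm_nonneg _).trans_lt (hM y hy)
    exact mul_pos hMpos ((hU.isClosed_compl.notMem_iff_infDist_pos hUne).1
      (not_not.2 (hM y hy : y ∈ U)))
  · rintro x ⟨hxU, hx⟩
    have hx := abs_lt.1 (show |K x - F x| < w x from hx)
    refine ⟨?_, le_of_lt hxU⟩
    simp only [g]
    rw [min_eq_left (by linarith), max_eq_right (by linarith)]

/-- A `C¹` function whose derivative is smaller than `M` on `Y` can be replaced, without changing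
its values and derivatives on `Y` by more than `ε`, by one with controlled derivative
everywhere. -/
theorem LipApprox.exists_bounded_fderiv (hX : LipApprox X C) (Y : Submodule ℝ X)
    (hY : IsClosed (Y : Set X)) {K : X → ℝ} (hK : ContDiff ℝ 1 K) {M : ℝ≥0}
    (hM : ∀ y ∈ Y, ‖fderiv ℝ K y‖ < M) {ε : ℝ} (hε : 0 < ε) :
    ∃ H : X → ℝ, ContDiff ℝ 1 H ∧ (∀ x, ‖fderiv ℝ H x‖ ≤ (2 * C + 1) * M + ε) ∧
      ∀ y ∈ Y, |H y - K y| ≤ ε ∧ ‖fderiv ℝ H y - fderiv ℝ K y‖ ≤ ε := by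
  classical
  obtain ⟨g, V, hg, hV, hYV, hgV⟩ := exists_lipschitzWith_eqOn_nhds Y hK hM
  -- At points of `Y` only the derivative of `K` is admissible; elsewhere only its size matters.
  let U : Bool → Set X := fun b => bif b then V else (Y : Set X)ᶜ
  let Q : X → Set (X →L[ℝ] ℝ) := fun x =>
    closedBall 0 ((2 * C + 1) * M) ∩ if x ∈ Y then {fderiv ℝ K x} else univ
  have hQ : ∀ x, Convex ℝ (Q x) := fun x => by
    refine (convex_closedBall _ _).inter ?_
    split_ifs
    exacts [convex_singleton _, convex_univ]
  have hloc : ∀ i, ∀ η : ℝ, 0 < η → ∃ k : X → ℝ, (∀ x ∈ U i, ContDiffAt ℝ 1 k x) ∧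
      ∀ x ∈ U i ∩ univ, |k x - g x| ≤ η ∧ fderiv ℝ k x ∈ Q x := by
    have hCM : (0 : ℝ) ≤ C * M := by positivity
    rintro (_ | _) η hη
    · obtain ⟨k, hk, hkg, hkL⟩ := hX _ g hg η hη
      refine ⟨k, fun x _ => hk.contDiffAt, ?_⟩
      rintro x ⟨hx, -⟩
      refine ⟨by rw [abs_sub_comm]; exact (hkg x).le, ?_, ?_⟩
      · rw [mem_closedBall_zero_iff]
        refine (norm_fderiv_le_of_lipschitz ℝ hkL).trans ?_
        push_cast
        linarith [M.2]
      · rw [if_neg (show x ∉ Y from hx)]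
        trivial
    · refine ⟨K, fun x _ => hK.contDiffAt, ?_⟩
      rintro x ⟨hx, -⟩
      obtain ⟨h1, h2⟩ := hgV x hx
      refine ⟨by rw [h1, sub_self, abs_zero]; exact hη.le, ?_, ?_⟩
      · rw [mem_closedBall_zero_iff]
        linarith
      · split_ifs <;> simp
  obtain ⟨H, hH, hHS⟩ := hX.exists_glue U (fun b => by
      cases b
      exacts [hY.isOpen_compl, hV])
    (fun x => by
      by_cases hx : x ∈ Y
      exacts [⟨true, hYV hx⟩, ⟨false, hx⟩]) univ g Q hQ hloc hε
  refine ⟨H, hH, fun x => ?_, fun y hy => ?_⟩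
  · obtain ⟨-, T, ⟨hT, -⟩, hHT⟩ := hHS x trivial
    have := norm_le_norm_add_norm_sub' (fderiv ℝ H x) T
    rw [mem_closedBall_zero_iff] at hT
    linarith
  · obtain ⟨h1, T, ⟨-, hT⟩, hHT⟩ := hHS y trivial
    rw [if_pos hy, mem_singleton_iff] at hT
    rw [(hgV y (hYV hy)).1] at h1
    exact ⟨h1, hT ▸ hHT⟩

/-! ### Extension by successive approximation -/

theorem fderiv_sub_restrict {Y : Submodule ℝ X} {f : Y → ℝ} {H : X → ℝ} (hf : ContDiff ℝ 1 f)
    (hH : ContDiff ℝ 1 H) (y : Y) :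
    fderiv ℝ (fun z : Y => f z - H z) y =
      fderiv ℝ f y - (fderiv ℝ H y).comp Y.subtypeL := by
  have h1 : HasFDerivAt (fun z : Y => H z) ((fderiv ℝ H y).comp Y.subtypeL) y :=
    (hH.differentiable one_ne_zero (y : X)).hasFDerivAt.comp y Y.subtypeL.hasFDerivAt
  exact ((hf.differentiable one_ne_zero y).hasFDerivAt.sub h1).fderiv

theorem contDiff_sub_restrict {Y : Submodule ℝ X} {f : Y → ℝ} {H : X → ℝ} (hf : ContDiff ℝ 1 f)
    (hH : ContDiff ℝ 1 H) : ContDiff ℝ 1 fun z : Y => f z - H z :=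
  hf.sub (hH.comp Y.subtypeL.contDiff)

/-- One step of the successive approximation: a `C¹` function on `Y` with derivative bounded by `a`
is the restriction of a `C¹` function with derivative bounded by a multiple of `a`, up to a
remainder with value and derivative bounded by `a / 2`. -/
theorem LipApprox.exists_halving (hX : LipApprox X C) (Y : Submodule ℝ X)
    (hY : IsClosed (Y : Set X)) {a : ℝ} (ha : 0 < a) {f : Y → ℝ} (hf : ContDiff ℝ 1 f)
    (hfa : ∀ y, ‖fderiv ℝ f y‖ ≤ a) :
    ∃ H : X → ℝ, ContDiff ℝ 1 H ∧ (∀ x, ‖fderiv ℝ H x‖ ≤ (4 * C + 3) * a) ∧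
      ∀ y : Y, |f y - H y| ≤ a / 2 ∧ ‖fderiv ℝ (fun z : Y => f z - H z) y‖ ≤ a / 2 := by
  have ha4 : 0 < a / 4 := by positivity
  obtain ⟨K, hK, hKf⟩ := hX.exists_approx_of_contDiff Y hY hf ha4
  have hM : ((2 * a).toNNReal : ℝ) = 2 * a := Real.coe_toNNReal _ (by positivity)
  obtain ⟨H, hH, hHb, hHK⟩ := hX.exists_bounded_fderiv Y hY hK (M := (2 * a).toNNReal)
    (fun y hy => by
      have h1 := (hKf ⟨y, hy⟩).2.2
      have h2 := hfa ⟨y, hy⟩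
      rw [hM]
      linarith) ha4
  refine ⟨H, hH, fun x => (hHb x).trans ?_, fun y => ?_⟩
  · rw [hM]
    linarith
  obtain ⟨h1, h2, -⟩ := hKf y
  obtain ⟨h3, h4⟩ := hHK y y.2
  constructor
  · rw [abs_le] at *
    constructor <;> linarith
  · have h5 : ‖(fderiv ℝ H y - fderiv ℝ K y).comp Y.subtypeL‖ ≤ a / 4 :=
      (ContinuousLinearMap.opNorm_comp_le _ _).trans
        ((mul_le_of_le_one_right (norm_nonneg _) Y.norm_subtypeL_le).trans h4)
    have h6 := norm_add_le ((fderiv ℝ H y - fderiv ℝ K y).comp Y.subtypeL)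
      ((fderiv ℝ K y).comp Y.subtypeL - fderiv ℝ f y)
    rw [ContinuousLinearMap.sub_comp, sub_add_sub_cancel] at h6
    rw [ContinuousLinearMap.sub_comp] at h5
    have h7 := norm_sub_rev (fderiv ℝ f y) ((fderiv ℝ H y).comp Y.subtypeL)
    rw [fderiv_sub_restrict hf hH]
    exact h7.trans_le (by linarith)

/-- A `C¹` function with bounded derivative on a closed subspace extends to a `C¹` function with
bounded derivative: sum the functions obtained by halving the remainder repeatedly. -/
theorem LipApprox.exists_extension (hX : LipApprox X C) (Y : Submodule ℝ X)
    (hY : IsClosed (Y : Set X)) {a : ℝ} (ha : 0 < a) {f : Y → ℝ} (hf : ContDiff ℝ 1 f)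
    (hfa : ∀ y, ‖fderiv ℝ f y‖ ≤ a) :
    ∃ H : X → ℝ, ContDiff ℝ 1 H ∧ (∀ x, ‖fderiv ℝ H x‖ ≤ (8 * C + 6) * a) ∧
      ∀ y : Y, H y = f y := by
  let P : ℕ → (Y → ℝ) → Prop := fun n f => ContDiff ℝ 1 f ∧ ∀ y, ‖fderiv ℝ f y‖ ≤ a / 2 ^ n
  have hstep : ∀ n (f : {f // P n f}), ∃ H : X → ℝ, ContDiff ℝ 1 H ∧
      (∀ x, ‖fderiv ℝ H x‖ ≤ (4 * C + 3) * (a / 2 ^ n)) ∧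
      ∀ y : Y, |f.1 y - H y| ≤ a / 2 ^ n / 2 ∧
        ‖fderiv ℝ (fun z : Y => f.1 z - H z) y‖ ≤ a / 2 ^ n / 2 := fun n f =>
    hX.exists_halving Y hY (by positivity) f.2.1 f.2.2
  choose G hG hGb hGf using hstep
  let p : ∀ n, {f // P n f} := fun n => Nat.rec ⟨f, hf, fun y => by simpa using hfa y⟩
    (fun n q => ⟨fun y => q.1 y - G n q y, contDiff_sub_restrict q.2.1 (hG n q), fun y => by
      rw [pow_succ, ← div_div]
      exact (hGf n q y).2⟩) n
  let h : ℕ → X → ℝ := fun n => G n (p n)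
  have hp0 : (p 0).1 = f := rfl
  have hps : ∀ n y, (p (n + 1)).1 y = (p n).1 y - h n y := fun n y => rfl
  let B : ℝ := (8 * C + 6) * a
  have hhb : ∀ n x, ‖fderiv ℝ (h n) x‖ ≤ B / 2 / 2 ^ n := fun n x =>
    (hGb n (p n) x).trans_eq (by simp only [B]; ring)
  have hhc : ∀ n, ContDiff ℝ 1 (h n) := fun n => hG n (p n)
  have hu : Summable fun n : ℕ => B / 2 / 2 ^ n := summable_geometric_two' B
  have hpartial : ∀ N (y : Y), ∑ n ∈ Finset.range N, h n y = f y - (p N).1 y := by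
    intro N y
    induction N with
    | zero => simp [hp0]
    | succ N ih => rw [Finset.sum_range_succ, ih, hps]; ring
  -- The remainders vanish in the limit, so the series sums to `f` on `Y`.
  have hsmall : ∀ n (y : Y), |(p (n + 1)).1 y| ≤ a / 2 / 2 ^ n := fun n y =>
    (hGf n (p n) y).1.trans_eq (div_right_comm _ _ _)
  have hlim : ∀ y : Y, Tendsto (fun N => ∑ n ∈ Finset.range N, h n y) atTop (𝓝 (f y)) := by
    intro y
    have h0 : Tendsto (fun n => (p (n + 1)).1 y) atTop (𝓝 0) :=
      squeeze_zero_norm (fun n => hsmall n y) (summable_geometric_two' a).tendsto_atTop_zero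
    have h1 := (tendsto_add_atTop_iff_nat (f := fun n => (p n).1 y) 1).1 h0
    simpa only [hpartial, sub_zero] using h1.const_sub (f y)
  have hsum0 : Summable fun n => h n 0 := by
    rw [← summable_nat_add_iff 1]
    refine Summable.of_norm_bounded (summable_geometric_two' (2 * a)) fun n => ?_
    have h1 := hsmall n 0
    have h2 := hsmall (n + 1) 0
    have h3 : h (n + 1) 0 = (p (n + 1)).1 0 - (p (n + 1 + 1)).1 0 := by
      rw [hps (n + 1) 0, sub_sub_cancel, ZeroMemClass.coe_zero]
    have h4 : a / 2 / 2 ^ (n + 1) ≤ a / 2 / 2 ^ n :=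
      div_le_div_of_nonneg_left (by positivity) (by positivity)
        (pow_le_pow_right₀ one_le_two n.le_succ)
    have h5 : 2 * a / 2 / 2 ^ n = a / 2 / 2 ^ n + a / 2 / 2 ^ n := by ring
    rw [h3, Real.norm_eq_abs, h5]
    exact (abs_sub _ _).trans (by linarith)
  have hhd : ∀ n x, HasFDerivAt (h n) (fderiv ℝ (h n) x) x := fun n x =>
    ((hhc n).differentiable one_ne_zero x).hasFDerivAt
  have hder : ∀ x, HasFDerivAt (fun x => ∑' n, h n x) (∑' n, fderiv ℝ (h n) x) x :=
    hasFDerivAt_tsum hu hhd hhb hsum0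
  refine ⟨fun x => ∑' n, h n x, contDiff_one_iff_fderiv.2 ⟨fun x => (hder x).differentiableAt, ?_⟩,
    fun x => ?_, fun y => ?_⟩
  · rw [show fderiv ℝ (fun x => ∑' n, h n x) = fun x => ∑' n, fderiv ℝ (h n) x from
      funext fun x => (hder x).fderiv]
    exact continuous_tsum (fun n => (hhc n).continuous_fderiv one_ne_zero) hu hhb
  · rw [(hder x).fderiv]
    exact tsum_of_norm_bounded (hasSum_geometric_two' B) fun n => hhb n x
  · exact tendsto_nhds_unique
      (summable_of_summable_hasFDerivAt hu hhd hhb hsum0 y).hasSum.tendsto_sum_nat (hlim y)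

end

theorem theorem1p1 {X : Type*} [NormedAddCommGroup X] [NormedSpace ℝ X] [CompleteSpace X]
    (hX : PropertyStar X) :
    (∀ Y : Submodule ℝ X, IsClosed (Y : Set X) → ∀ f : Y → ℝ, ContDiff ℝ 1 f →
      ∃ H : X → ℝ, ContDiff ℝ 1 H ∧ ∀ y : Y, H y = f y) ∧
    (∃ C : ℝ≥0, ∀ Y : Submodule ℝ X, IsClosed (Y : Set X) → ∀ f : Y → ℝ, ContDiff ℝ 1 f →
      (∃ L : ℝ≥0, LipschitzWith L f) →
      ∃ H : X → ℝ, ContDiff ℝ 1 H ∧ (∃ L : ℝ≥0, LipschitzWith L H) ∧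
        (∀ y : Y, H y = f y) ∧ lipConst H ≤ C * lipConst f) := by
  obtain ⟨C, hC⟩ := hX.exists_lipApprox
  refine ⟨fun Y hY f hf => ?_, 8 * C + 6, fun Y hY f hf hL => ?_⟩
  · -- Subtracting a first approximation leaves a remainder with bounded derivative.
    obtain ⟨K, hK, hKf⟩ := hC.exists_approx_of_contDiff Y hY hf one_pos
    obtain ⟨H, hH, -, hHf⟩ := hC.exists_extension Y hY one_pos (contDiff_sub_restrict hf hK)
      fun y => by
        have h := norm_sub_rev (fderiv ℝ f y) ((fderiv ℝ K y).comp Y.subtypeL)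
        rw [fderiv_sub_restrict hf hK]
        exact h.trans_le (hKf y).2.1
    exact ⟨fun x => H x + K x, hH.add hK, fun y => add_eq_of_eq_sub (hHf y)⟩
  · have hlip := lipschitzWith_lipConst hL
    rcases eq_zero_or_pos (lipConst f) with h0 | hpos
    · have hconst : ∀ y, f y = f 0 := fun y => by
        have := hlip.dist_le_mul y 0
        rw [h0, NNReal.coe_zero, zero_mul] at this
        exact dist_le_zero.1 this
      have hH : LipschitzWith 0 fun _ : X => f 0 := LipschitzWith.const _
      exact ⟨fun _ => f 0, contDiff_const, ⟨0, hH⟩, fun y => (hconst y).symm,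
        (lipConst_le hH).trans zero_le⟩
    · obtain ⟨H, hH, hHb, hHf⟩ := hC.exists_extension Y hY (NNReal.coe_pos.2 hpos) hf
        fun y => norm_fderiv_le_of_lipschitz ℝ hlip
      have hHL : LipschitzWith ((8 * C + 6) * lipConst f) H :=
        lipschitzWith_of_nnnorm_fderiv_le (hH.differentiable one_ne_zero) fun x => by
          rw [← NNReal.coe_le_coe, coe_nnnorm]
          push_cast
          exact hHb x
      exact ⟨H, hH, ⟨_, hHL⟩, hHf, lipConst_le hHL⟩
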